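/- Let $\mathbb{K}=\mathbb{R}$ or $\mathbb{K}=\mathbb{C}$, let $H$ be a finite-dimensional Hilbert space over $\mathbb{K}$, let $\mathcal{V}\subseteq H$ be a linear subspace, and let $\Lambda: H\to\mathbb{K}^m$ be a linear map with $\mathcal{V}\cap\ker\Lambda=\{0\}$, where $\mathbb{K}^m$ carries the $\ell_2$-norm. Let $\varepsilon>0$ and $\eta\ge 0$, and put $$\mathcal{K}=\{f\in H:\ \mathrm{dist}(f,\mathcal{V})\le\varepsilon\},\qquad \mathcal{E}=\{e\in\mathbb{K}^m:\ \|e\|_2\le\eta\}.$$ For an arbitrary (not necessarily linear) map $\Delta:\mathbb{K}^m\to H$, define its global worst-case error by $$\mathrm{gwce}(\Delta)=\sup_{f\in\mathcal{K},\ e\in\mathcal{E}}\|f-\Delta(\Lambda f+e)\|\in[0,\infty].$$ Let $P_{\mathcal{V}^\perp}$ be the orthogonal projector onto $\mathcal{V}^\perp$, and consider the semidefinite program $$\min_{c,d\ge 0}\ c\,\varepsilon^2+d\,\eta^2\qquad\text{subject to}\qquad cP_{\mathcal{V}^\perp}+d\Lambda^*\Lambda\succeq\mathrm{Id}.$$ If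 $\eta>0$, this program has a solution. Moreover, for every solution $(c_\flat,d_\flat)$, set $\tau_\flat=d_\flat/(c_\flat+d_\flat)$ (with $\tau_\flat=0$ if $c_\flat=d_\flat=0$, which can occur only if $H=\{0\}$). Then for every $y\in\mathbb{K}^m$ the program $$\min_{f\in H}\ (1-\tau_\flat)\|P_{\mathcal{V}^\perp}f\|^2+\tau_\flat\|\Lambda f-y\|_2^2$$ has a unique minimizer $\Delta_{\tau_\flat}(y)$, the map $\Delta_{\tau_\flat}:\mathbb{K}^m\to H$ is linear, and it is a globally optimal recovery map: $$\mathrm{gwce}(\Delta_{\tau_\flat})=\inf_{\Delta:\mathbb{K}^m\to H}\mathrm{gwce}(\Delta),$$ the infimum being taken over all maps $\Delta:\mathbb{K}^m\to H$. -/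

import Mathlib

noncomputable section

namespace OptRec

open scoped ENNReal

section

variable {𝕜 : Type*} [RCLike 𝕜] {H : Type*} [NormedAddCommGroup H] [InnerProductSpace 𝕜 H]
  {m : ℕ}

/-- The approximability set of all elements of `H` at distance at most `ε` from `V`. -/
def approxSet (V : Submodule 𝕜 H) (ε : ℝ) : Set H :=
  {f | Metric.infDist f (V : Set H) ≤ ε}

/-- The uncertainty set of all error vectors of `ℓ₂`-norm at most `η`. -/
def uncertaintySet (𝕜 : Type*) [RCLike 𝕜] (m : ℕ) (η : ℝ) : Set (EuclideanSpace 𝕜 (Fin m)) :=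
  {e | ‖e‖ ≤ η}

/-- The global worst-case error of an arbitrary recovery map `Δ`, with values in `[0, ∞]`. -/
def gwce (K : Set H) (E : Set (EuclideanSpace 𝕜 (Fin m)))
    (Λ : H →ₗ[𝕜] EuclideanSpace 𝕜 (Fin m)) (Δ : EuclideanSpace 𝕜 (Fin m) → H) : ℝ≥0∞ :=
  ⨆ f ∈ K, ⨆ e ∈ E, ‖f - Δ (Λ f + e)‖ₑ

variable [FiniteDimensional 𝕜 H]

/-- The objective function `(1 - τ) ‖P f‖² + τ ‖Λ f - y‖²` of the regularization program, where
`P` is the orthogonal projector onto the orthogonal complement of `V`. -/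
def regObjective (V : Submodule 𝕜 H) (Λ : H →ₗ[𝕜] EuclideanSpace 𝕜 (Fin m)) (τ : ℝ)
    (y : EuclideanSpace 𝕜 (Fin m)) (f : H) : ℝ :=
  (1 - τ) * ‖Vᗮ.starProjection f‖ ^ 2 + τ * ‖Λ f - y‖ ^ 2

/-- `Δ` is the regularization map with parameter `τ`: for each `y`, the regularization program
has `Δ y` as its one and only minimizer. -/
def IsRegularizationMap (V : Submodule 𝕜 H) (Λ : H →ₗ[𝕜] EuclideanSpace 𝕜 (Fin m)) (τ : ℝ)
    (Δ : EuclideanSpace 𝕜 (Fin m) → H) : Prop :=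
  ∀ (y : EuclideanSpace 𝕜 (Fin m)) (f : H),
    IsMinOn (regObjective V Λ τ y) Set.univ f ↔ f = Δ y

/-- The feasible set of the semidefinite program: the pairs `(c, d)` of nonnegative numbers such
that `c P + d Λ* Λ - Id` is positive semidefinite. -/
def sdpFeasible (V : Submodule 𝕜 H) (Λ : H →ₗ[𝕜] EuclideanSpace 𝕜 (Fin m)) : Set (ℝ × ℝ) :=
  {p | 0 ≤ p.1 ∧ 0 ≤ p.2 ∧
    ((p.1 : 𝕜) • (Vᗮ.starProjection : H →ₗ[𝕜] H) + (p.2 : 𝕜) • (LinearMap.adjoint Λ ∘ₗ Λ)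
      - LinearMap.id).IsPositive}

/-- `(c, d)` is a solution of the semidefinite program: minimize `c ε² + d η²` over the
feasible set. -/
def IsSDPSolution (V : Submodule 𝕜 H) (Λ : H →ₗ[𝕜] EuclideanSpace 𝕜 (Fin m)) (ε η c d : ℝ) :
    Prop :=
  (c, d) ∈ sdpFeasible V Λ ∧
    IsMinOn (fun p : ℝ × ℝ => p.1 * ε ^ 2 + p.2 * η ^ 2) (sdpFeasible V Λ) (c, d)

end

end OptRec

end

namespace OptRec

open scoped ENNReal InnerProductSpace

section

variable {𝕜 : Type*} [RCLike 𝕜] {H : Type*} [NormedAddCommGroup H] [InnerProductSpace 𝕜 H]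
  {m : ℕ}

/-! The worst-case error of one linear map is matched with the norm of one vector. Upper bound:
feasibility of (c, d) means ‖f‖² ≤ c‖Pf‖² + d‖Λf‖². Pairing the normal equation with the recovery
error then bounds the squared error by cε² + dη² (`norm_sub_regMap_sq_le`). Lower bound: if ‖Pf‖ ≤ ε
and ‖Λf‖ ≤ η, then f and -f can both produce the observation 0, so no map errs by less than ‖f‖
(`enorm_le_gwce`). The bounds meet by strong duality (`IsSDPSolution.exists_le_norm_sq`). Moving (c,
d) along ±(η², -ε²) keeps the objective, so optimality yields tight vectors where η²‖Pf‖² - ε²‖Λf‖²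
takes either sign. Sums of tight vectors are tight, so an intermediate value argument gives a tight
vector where this form vanishes, and rescaling it meets both constraints with equality. If c or d is
zero, one sign suffices. -/

/-- Every recovery map has worst-case error at least the norm of any element `f` of the symmetric
model set whose observation may be cancelled by an admissible error. -/
theorem enorm_le_gwce {K : Set H} {E : Set (EuclideanSpace 𝕜 (Fin m))}
    {Λ : H →ₗ[𝕜] EuclideanSpace 𝕜 (Fin m)} (Δ : EuclideanSpace 𝕜 (Fin m) → H) {f : H}
    (hf : f ∈ K) (hf' : -f ∈ K) (he : Λ f ∈ E) (he' : -Λ f ∈ E) :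
    ‖f‖ₑ ≤ gwce K E Λ Δ := by
  have h1 : ‖f - Δ 0‖ₑ ≤ gwce K E Λ Δ := by
    have := le_iSup₂_of_le (f := fun g (_ : g ∈ K) => ⨆ e ∈ E, ‖g - Δ (Λ g + e)‖ₑ) f hf
      (le_iSup₂ (f := fun e (_ : e ∈ E) => ‖f - Δ (Λ f + e)‖ₑ) (-Λ f) he')
    simpa [gwce] using this
  have h2 : ‖-f - Δ 0‖ₑ ≤ gwce K E Λ Δ := by
    have := le_iSup₂_of_le (f := fun g (_ : g ∈ K) => ⨆ e ∈ E, ‖g - Δ (Λ g + e)‖ₑ) (-f) hf'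
      (le_iSup₂ (f := fun e (_ : e ∈ E) => ‖-f - Δ (Λ (-f) + e)‖ₑ) (Λ f) he)
    simpa [gwce] using this
  by_cases htop : gwce K E Λ Δ = ⊤
  · simp [htop]
  lift gwce K E Λ Δ to NNReal using htop with w
  rw [enorm_le_coe] at *
  have h1' : ‖f - Δ 0‖ ≤ w := h1
  have h2' : ‖-f - Δ 0‖ ≤ w := h2
  have h3 : ‖(f - Δ 0) - (-f - Δ 0)‖ ≤ ‖f - Δ 0‖ + ‖-f - Δ 0‖ := norm_sub_le _ _
  have h4 : (f - Δ 0) - (-f - Δ 0) = (2 : 𝕜) • f := by rw [two_smul]; abel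
  rw [h4, norm_smul, RCLike.norm_two] at h3
  have : ‖f‖ ≤ w := by linarith
  exact this

/-- If `Q ≥ 0` on a compact set and `R > 0` wherever `Q` vanishes on it, then `Q + t R > 0` for all
small `t > 0`. -/
theorem exists_forall_add_mul_pos {X : Type*} [TopologicalSpace X] {S : Set X} (hS : IsCompact S)
    {Q R : X → ℝ} (hQ : Continuous Q) (hR : Continuous R)
    (hQ0 : ∀ x ∈ S, 0 ≤ Q x) (hQR : ∀ x ∈ S, Q x = 0 → 0 < R x) :
    ∃ t₀ : ℝ, 0 < t₀ ∧ ∀ t, 0 < t → t ≤ t₀ → ∀ x ∈ S, 0 < Q x + t * R x := by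
  have hT : IsCompact (S ∩ {x | R x ≤ 0}) :=
    hS.inter_right (isClosed_le hR continuous_const)
  rcases (S ∩ {x | R x ≤ 0}).eq_empty_or_nonempty with he | hne
  · refine ⟨1, one_pos, fun t ht _ x hx => ?_⟩
    have : 0 < R x := by
      by_contra h
      have : x ∈ S ∩ {x | R x ≤ 0} := ⟨hx, not_lt.mp h⟩
      simp [he] at this
    have := hQ0 x hx
    positivity
  · obtain ⟨x₁, hx₁, hmin₁⟩ := hT.exists_isMinOn hne hQ.continuousOn
    obtain ⟨x₂, hx₂, hmin₂⟩ := hT.exists_isMinOn hne hR.continuousOn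
    have ha : 0 < Q x₁ := by
      refine lt_of_le_of_ne (hQ0 _ hx₁.1) fun h => ?_
      have h1 := hQR _ hx₁.1 h.symm
      have h2 : R x₁ ≤ 0 := hx₁.2
      linarith
    have hB : R x₂ ≤ 0 := hx₂.2
    -- The 1 in the denominator covers `R x₂ = 0` and leaves a margin: `Q x + t * R x ≥ Q x₁ + t * R
    -- x₂ ≥ t > 0`.
    refine ⟨Q x₁ / (1 - R x₂), by apply div_pos ha; linarith, fun t ht htt x hx => ?_⟩
    rw [le_div_iff₀ (by linarith)] at htt
    rcases lt_or_ge 0 (R x) with h | h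
    · have := hQ0 x hx
      positivity
    · have h1 : Q x₁ ≤ Q x := hmin₁ ⟨hx, h⟩
      have h2 : R x₂ ≤ R x := hmin₂ ⟨hx, h⟩
      nlinarith

/-- Cauchy–Schwarz for the weighted sum of two inner products. -/
theorem re_inner_add_re_inner_le {c d : ℝ} {F : Type*} [NormedAddCommGroup F] [InnerProductSpace 𝕜 F]
    (hc : 0 ≤ c) (hd : 0 ≤ d) (p q : H) (u v : F) :
    2 * (c * RCLike.re ⟪p, q⟫_𝕜 + d * RCLike.re ⟪u, v⟫_𝕜) ≤
      (c * ‖p‖ ^ 2 + d * ‖u‖ ^ 2) + (c * ‖q‖ ^ 2 + d * ‖v‖ ^ 2) := by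
  have h1 := norm_sub_sq (𝕜 := 𝕜) p q
  have h2 := norm_sub_sq (𝕜 := 𝕜) u v
  nlinarith [mul_nonneg hc (sq_nonneg ‖p - q‖), mul_nonneg hd (sq_nonneg ‖u - v‖)]

variable [FiniteDimensional 𝕜 H]

/-! ### The energy form and feasibility -/

theorem infDist_eq_norm_starProjection_orthogonal (V : Submodule 𝕜 H) (f : H) :
    Metric.infDist f (V : Set H) = ‖Vᗮ.starProjection f‖ := by
  rw [V.starProjection_orthogonal_val, V.starProjection_minimal, Metric.infDist_eq_iInf]
  simp [dist_eq_norm]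

/-- The quadratic form `c ‖P f‖² + d ‖Λ f‖²`. -/
noncomputable def energy (V : Submodule 𝕜 H) (Λ : H →ₗ[𝕜] EuclideanSpace 𝕜 (Fin m)) (c d : ℝ) (f : H) : ℝ :=
  c * ‖Vᗮ.starProjection f‖ ^ 2 + d * ‖Λ f‖ ^ 2

/-- The operator `c P + d Λ* Λ`. -/
noncomputable def energyOp (V : Submodule 𝕜 H) (Λ : H →ₗ[𝕜] EuclideanSpace 𝕜 (Fin m)) (c d : ℝ) : H →ₗ[𝕜] H :=
  (c : 𝕜) • (Vᗮ.starProjection : H →ₗ[𝕜] H) + (d : 𝕜) • (LinearMap.adjoint Λ ∘ₗ Λ)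

variable {V : Submodule 𝕜 H} {Λ : H →ₗ[𝕜] EuclideanSpace 𝕜 (Fin m)} {c d ε η : ℝ}

theorem inner_starProjection_eq (U : Submodule 𝕜 H) (f g : H) :
    ⟪U.starProjection f, g⟫_𝕜 = ⟪U.starProjection f, U.starProjection g⟫_𝕜 := by
  rw [← U.inner_starProjection_left_eq_right,
    U.starProjection_eq_self_iff.mpr (U.starProjection_apply_mem f)]

theorem inner_energyOp (f g : H) :
    ⟪energyOp V Λ c d f, g⟫_𝕜 =
      (c : 𝕜) * ⟪Vᗮ.starProjection f, Vᗮ.starProjection g⟫_𝕜 + (d : 𝕜) * ⟪Λ f, Λ g⟫_𝕜 := by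
  rw [← inner_starProjection_eq]
  simp [energyOp, inner_add_left, inner_smul_left, LinearMap.adjoint_inner_left]

theorem re_inner_energyOp_self (f : H) :
    RCLike.re ⟪energyOp V Λ c d f, f⟫_𝕜 = energy V Λ c d f := by
  rw [inner_energyOp, map_add, RCLike.re_ofReal_mul, RCLike.re_ofReal_mul,
    ← norm_sq_eq_re_inner, ← norm_sq_eq_re_inner, energy]

theorem mem_sdpFeasible_iff :
    (c, d) ∈ sdpFeasible V Λ ↔ 0 ≤ c ∧ 0 ≤ d ∧ ∀ f, ‖f‖ ^ 2 ≤ energy V Λ c d f := by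
  have key : ∀ f, RCLike.re ⟪(energyOp V Λ c d - LinearMap.id : H →ₗ[𝕜] H) f, f⟫_𝕜 =
      energy V Λ c d f - ‖f‖ ^ 2 := fun f => by
    rw [LinearMap.sub_apply, inner_sub_left, map_sub, re_inner_energyOp_self,
      LinearMap.id_apply, ← norm_sq_eq_re_inner]
  have hsymm : (energyOp V Λ c d - LinearMap.id : H →ₗ[𝕜] H).IsSymmetric := fun f g => by
    rw [LinearMap.sub_apply, LinearMap.sub_apply, inner_sub_left, inner_sub_right, inner_energyOp,
      ← inner_conj_symm f (energyOp V Λ c d g), inner_energyOp]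
    simp
  refine and_congr_right fun _ => and_congr_right fun _ =>
    ⟨fun h f => ?_, fun h => ⟨hsymm, fun f => ?_⟩⟩
  · exact sub_nonneg.mp ((h.2 f).trans_eq (key f))
  · exact (sub_nonneg.mpr (h f)).trans_eq (key f).symm

theorem continuous_energy (c d : ℝ) : Continuous (energy V Λ c d) := by
  have : Continuous Λ := Λ.continuous_of_finiteDimensional
  unfold energy
  fun_prop

theorem energy_smul (a : 𝕜) (f : H) : energy V Λ c d (a • f) = ‖a‖ ^ 2 * energy V Λ c d f := by
  simp only [energy, map_smul, norm_smul]
  ring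

theorem energy_parallelogram (f g : H) :
    energy V Λ c d (f + g) + energy V Λ c d (f - g) =
      2 * (energy V Λ c d f + energy V Λ c d g) := by
  have h1 := parallelogram_law_with_norm 𝕜 (Vᗮ.starProjection f) (Vᗮ.starProjection g)
  have h2 := parallelogram_law_with_norm 𝕜 (Λ f) (Λ g)
  simp only [energy, map_add, map_sub]
  linear_combination c * h1 + d * h2

theorem energy_nonneg (hc : 0 ≤ c) (hd : 0 ≤ d) (f : H) : 0 ≤ energy V Λ c d f := by
  unfold energy; positivity

/-- A form that is positive on nonzero vectors is bounded below by a positive multiple of the square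
of the norm. -/
theorem exists_pos_mul_norm_sq_le_energy {γ₀ : ℝ}
    (h : ∀ f : H, ‖f‖ = 1 → γ₀ < energy V Λ c d f) :
    ∃ γ, γ₀ < γ ∧ ∀ f : H, γ * ‖f‖ ^ 2 ≤ energy V Λ c d f := by
  have : ProperSpace H := FiniteDimensional.proper_rclike 𝕜 H
  obtain ⟨γ, hγ, hle⟩ : ∃ γ, γ₀ < γ ∧ ∀ f : H, ‖f‖ = 1 → γ ≤ energy V Λ c d f := by
    rcases (Metric.sphere (0 : H) 1).eq_empty_or_nonempty with he | hne
    · refine ⟨γ₀ + 1, by linarith, fun f hf => ?_⟩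
      have : f ∈ Metric.sphere (0 : H) 1 := by simpa using hf
      simp [he] at this
    · obtain ⟨x, hx, hmin⟩ := (isCompact_sphere (0 : H) 1).exists_isMinOn hne
        (continuous_energy (V := V) (Λ := Λ) c d).continuousOn
      exact ⟨_, h x (by simpa using hx), fun f hf => hmin (by simpa using hf)⟩
  refine ⟨γ, hγ, fun f => ?_⟩
  rcases eq_or_ne f 0 with rfl | hf
  · simp [energy]
  have hn : 0 < ‖f‖ := norm_pos_iff.mpr hf
  have h1 := hle (((‖f‖⁻¹ : ℝ) : 𝕜) • f) (by
    rw [norm_smul, RCLike.norm_ofReal, abs_of_pos (by positivity), inv_mul_cancel₀ hn.ne'])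
  rw [energy_smul, RCLike.norm_ofReal, abs_of_pos (by positivity), inv_pow,
    ← div_eq_inv_mul, le_div_iff₀ (by positivity)] at h1
  exact h1

/-! ### Optimality conditions and strong duality -/

/-- First-order optimality: at a solution, along every feasible direction of constant objective the
perturbed form is nonpositive at some nonzero vector where the constraint is tight. -/
theorem IsSDPSolution.exists_tight_energy_nonpos (hs : IsSDPSolution V Λ ε η c d)
    (hpos : 0 < c * ε ^ 2 + d * η ^ 2) {a b t₁ : ℝ} (hab : a * ε ^ 2 + b * η ^ 2 = 0)
    (ht₁ : 0 < t₁) (ha : ∀ t, 0 < t → t ≤ t₁ → 0 ≤ c + t * a)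
    (hb : ∀ t, 0 < t → t ≤ t₁ → 0 ≤ d + t * b) :
    ∃ f : H, f ≠ 0 ∧ energy V Λ c d f = ‖f‖ ^ 2 ∧ energy V Λ a b f ≤ 0 := by
  by_contra! hcon
  have : ProperSpace H := FiniteDimensional.proper_rclike 𝕜 H
  obtain ⟨hfeas, hmin⟩ := hs
  obtain ⟨-, -, hQ⟩ := mem_sdpFeasible_iff.mp hfeas
  obtain ⟨t₀, ht₀, hlt⟩ := exists_forall_add_mul_pos (isCompact_sphere (0 : H) 1)
    (Q := fun f => energy V Λ c d f - ‖f‖ ^ 2) (R := energy V Λ a b)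
    ((continuous_energy c d).sub (by fun_prop)) (continuous_energy a b)
    (fun f _ => sub_nonneg.mpr (hQ f)) (fun f hf h => hcon f (by rintro rfl; simp at hf)
      (sub_eq_zero.mp h))
  obtain ⟨t, ht, htt₀, htt₁⟩ : ∃ t, 0 < t ∧ t ≤ t₀ ∧ t ≤ t₁ :=
    ⟨min t₀ t₁, lt_min ht₀ ht₁, min_le_left _ _, min_le_right _ _⟩
  -- By compactness the perturbed form exceeds ‖f‖² by a factor γ > 1. Dividing the coefficients by
  -- γ keeps feasibility and strictly lowers the objective, which the direction (a, b) had left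
  -- unchanged.
  obtain ⟨γ, hγ, hle⟩ := exists_pos_mul_norm_sq_le_energy (V := V) (Λ := Λ) (c := c + t * a)
    (d := d + t * b) (γ₀ := 1) (fun f hf => by
      have := hlt t ht htt₀ f (by simpa using hf)
      simp only [energy, hf] at this ⊢
      linarith)
  have hγ0 : 0 < γ := by linarith
  have hmem : ((c + t * a) / γ, (d + t * b) / γ) ∈ sdpFeasible V Λ := by
    refine mem_sdpFeasible_iff.mpr ⟨div_nonneg (ha t ht htt₁) hγ0.le,
      div_nonneg (hb t ht htt₁) hγ0.le, fun f => ?_⟩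
    have h1 := hle f
    have h2 : energy V Λ ((c + t * a) / γ) ((d + t * b) / γ) f =
        energy V Λ (c + t * a) (d + t * b) f / γ := by simp only [energy]; ring
    rw [h2, le_div_iff₀ hγ0]
    linarith
  have h1 : c * ε ^ 2 + d * η ^ 2 ≤ (c + t * a) / γ * ε ^ 2 + (d + t * b) / γ * η ^ 2 := hmin hmem
  have h2 : (c + t * a) / γ * ε ^ 2 + (d + t * b) / γ * η ^ 2 = (c * ε ^ 2 + d * η ^ 2) / γ := by
    field_simp
    linear_combination t * hab
  rw [h2, le_div_iff₀ hγ0] at h1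
  nlinarith

/-- The excess of the energy over ‖·‖² is nonnegative and obeys the parallelogram law, so its zeros
are closed under addition. -/
theorem energy_add_eq_norm_sq (h : ∀ f : H, ‖f‖ ^ 2 ≤ energy V Λ c d f) {f g : H}
    (hf : energy V Λ c d f = ‖f‖ ^ 2) (hg : energy V Λ c d g = ‖g‖ ^ 2) :
    energy V Λ c d (f + g) = ‖f + g‖ ^ 2 := by
  have h1 := energy_parallelogram (V := V) (Λ := Λ) (c := c) (d := d) f g
  have h2 := parallelogram_law_with_norm 𝕜 f g
  have h3 := h (f + g)
  have h4 := h (f - g)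
  linarith

/-- On the subspace where the constraint is tight, a form taking both signs has a nontrivial
zero. -/
theorem exists_tight_energy_eq_zero (h : ∀ f : H, ‖f‖ ^ 2 ≤ energy V Λ c d f) {a b : ℝ} {f g : H}
    (hf0 : f ≠ 0) (hg0 : g ≠ 0) (hf : energy V Λ c d f = ‖f‖ ^ 2)
    (hg : energy V Λ c d g = ‖g‖ ^ 2) (hf' : energy V Λ a b f ≤ 0) (hg' : 0 ≤ energy V Λ a b g) :
    ∃ u : H, u ≠ 0 ∧ energy V Λ c d u = ‖u‖ ^ 2 ∧ energy V Λ a b u = 0 := by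
  let γ : ℝ → H := fun t => ((1 - t : ℝ) : 𝕜) • f + (t : 𝕜) • g
  have hγ : Continuous γ := by
    have : Continuous fun t : ℝ => (t : 𝕜) := RCLike.continuous_ofReal
    have : Continuous fun t : ℝ => ((1 - t : ℝ) : 𝕜) := by fun_prop
    fun_prop
  obtain ⟨t, -, ht⟩ := intermediate_value_Icc (zero_le_one' ℝ)
    ((continuous_energy (V := V) (Λ := Λ) a b).comp hγ).continuousOn
    (show (0 : ℝ) ∈ Set.Icc _ _ by simpa [γ] using ⟨hf', hg'⟩)
  have htight : energy V Λ c d (γ t) = ‖γ t‖ ^ 2 := by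
    refine energy_add_eq_norm_sq h ?_ ?_ <;> rw [energy_smul, norm_smul, mul_pow] <;> congr 1
  -- If the segment passes through 0, then `f` and `g` are proportional, so the form has the same
  -- sign at both and already vanishes at `f`.
  by_cases hγt : γ t = 0
  · refine ⟨f, hf0, hf, ?_⟩
    have h1 : ((1 - t : ℝ) : 𝕜) • f = (-t : 𝕜) • g := by
      rw [neg_smul]; exact eq_neg_of_add_eq_zero_left hγt
    have h2 : energy V Λ a b (((1 - t : ℝ) : 𝕜) • f) = energy V Λ a b ((-t : 𝕜) • g) := by rw [h1]
    rw [energy_smul, energy_smul, norm_neg, RCLike.norm_ofReal, RCLike.norm_ofReal, sq_abs,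
      sq_abs] at h2
    have ht1 : 1 - t ≠ 0 := fun h0 => by
      have : t = 1 := by linarith
      subst this
      simp [hg0] at h1
    have : 0 ≤ (1 - t) ^ 2 * energy V Λ a b f := h2 ▸ by positivity
    exact le_antisymm hf' (nonneg_of_mul_nonneg_right this (by positivity))
  · exact ⟨γ t, hγt, htight, ht⟩

/-- Strong duality: the value of the semidefinite program is attained by the squared norm of an
element compatible with zero data. -/
theorem IsSDPSolution.exists_le_norm_sq (hs : IsSDPSolution V Λ ε η c d) (hε : 0 < ε)
    (hη : 0 ≤ η) :
    ∃ f : H, ‖Vᗮ.starProjection f‖ ≤ ε ∧ ‖Λ f‖ ≤ η ∧ c * ε ^ 2 + d * η ^ 2 ≤ ‖f‖ ^ 2 := by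
  obtain ⟨hc, hd, hQ⟩ := mem_sdpFeasible_iff.mp hs.1
  rcases (show 0 ≤ c * ε ^ 2 + d * η ^ 2 by positivity).eq_or_lt with hpos | hpos
  · exact ⟨0, by simpa using hε.le, by simpa using hη, by simp [← hpos]⟩
  have down : 0 < d → ∃ f : H, f ≠ 0 ∧ energy V Λ c d f = ‖f‖ ^ 2 ∧
      energy V Λ (η ^ 2) (-ε ^ 2) f ≤ 0 := fun hd0 =>
    hs.exists_tight_energy_nonpos hpos (t₁ := d / ε ^ 2) (by ring) (by positivity)
      (fun t ht _ => by positivity)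
      (fun t _ ht => by rw [le_div_iff₀ (by positivity)] at ht; linarith)
  have up : 0 < c → ∃ f : H, f ≠ 0 ∧ energy V Λ c d f = ‖f‖ ^ 2 ∧
      0 ≤ energy V Λ (η ^ 2) (-ε ^ 2) f := fun hc0 => by
    obtain ⟨f, h1, h2, h3⟩ := hs.exists_tight_energy_nonpos hpos (a := -η ^ 2) (b := ε ^ 2)
      -- The `+ 1` keeps the bound meaningful when η = 0.
      (t₁ := c / (η ^ 2 + 1)) (by ring) (by positivity)
      (fun t ht0 ht => by rw [le_div_iff₀ (by positivity)] at ht; linarith)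
      (fun t ht _ => by positivity)
    refine ⟨f, h1, h2, ?_⟩
    simp only [energy] at h3 ⊢
    linarith
  -- rescaling a tight vector with the right ratio of seminorms
  have scale : ∀ f : H, ∀ s : ℝ, 0 ≤ s → energy V Λ c d f = ‖f‖ ^ 2 →
      s * ‖Vᗮ.starProjection f‖ ≤ ε → s * ‖Λ f‖ ≤ η →
      c * ε ^ 2 + d * η ^ 2 ≤ c * (s * ‖Vᗮ.starProjection f‖) ^ 2 + d * (s * ‖Λ f‖) ^ 2 →
      ∃ f : H, ‖Vᗮ.starProjection f‖ ≤ ε ∧ ‖Λ f‖ ≤ η ∧ c * ε ^ 2 + d * η ^ 2 ≤ ‖f‖ ^ 2 := by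
    intro f s hs0 hf h1 h2 h3
    refine ⟨(s : 𝕜) • f, ?_, ?_, ?_⟩
    · rwa [map_smul, norm_smul, RCLike.norm_ofReal, abs_of_nonneg hs0]
    · rwa [map_smul, norm_smul, RCLike.norm_ofReal, abs_of_nonneg hs0]
    · refine h3.trans_eq ?_
      rw [norm_smul, RCLike.norm_ofReal, abs_of_nonneg hs0, mul_pow _ ‖f‖, ← hf, energy]
      ring
  -- a tight vector with nonzero projection that satisfies the `Λ` bound in ratio
  have scaleP : ∀ f : H, f ≠ 0 → energy V Λ c d f = ‖f‖ ^ 2 →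
      ‖Vᗮ.starProjection f‖ ≠ 0 → 0 ≤ energy V Λ (η ^ 2) (-ε ^ 2) f →
      -- When d = 0 the Λ-term does not enter the objective, so ‖Λf‖ need not reach η after
      -- rescaling.
      (0 < d → energy V Λ (η ^ 2) (-ε ^ 2) f = 0) →
      ∃ f : H, ‖Vᗮ.starProjection f‖ ≤ ε ∧ ‖Λ f‖ ≤ η ∧ c * ε ^ 2 + d * η ^ 2 ≤ ‖f‖ ^ 2 := by
    intro f _ hf hP hq hq0
    simp only [energy] at hq hq0
    have hP' : 0 < ‖Vᗮ.starProjection f‖ := (norm_nonneg _).lt_of_ne' hP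
    have hsP : ε / ‖Vᗮ.starProjection f‖ * ‖Vᗮ.starProjection f‖ = ε := div_mul_cancel₀ _ hP
    have hle : ε * ‖Λ f‖ ≤ η * ‖Vᗮ.starProjection f‖ :=
      le_of_sq_le_sq (by linarith) (by positivity)
    refine scale f (ε / ‖Vᗮ.starProjection f‖) (by positivity) hf hsP.le ?_ ?_
    · rwa [div_mul_eq_mul_div, div_le_iff₀ hP']
    · rw [hsP]
      rcases hd.eq_or_lt with h0 | h0
      · simp [← h0]
      · have := hq0 h0
        have h1 : (ε / ‖Vᗮ.starProjection f‖ * ‖Λ f‖) ^ 2 = η ^ 2 := by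
          field_simp
          linarith
        rw [h1]
  have Pne : ∀ f : H, f ≠ 0 → energy V Λ c d f = ‖f‖ ^ 2 →
      0 ≤ energy V Λ (η ^ 2) (-ε ^ 2) f → ‖Vᗮ.starProjection f‖ ≠ 0 := by
    intro f hf0 hf hq hP
    simp only [energy, hP] at hq hf
    have hΛ : ‖Λ f‖ ^ 2 = 0 := by
      have : 0 ≤ ‖Λ f‖ ^ 2 := by positivity
      have : 0 < ε ^ 2 := by positivity
      nlinarith
    rw [hΛ] at hf
    have : ‖f‖ ^ 2 = 0 := by rw [← hf]; ring
    simp [hf0] at this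
  rcases hd.eq_or_lt with hd0 | hd0
  · have hc0 : 0 < c := hc.lt_of_ne fun h => by simp [← h, ← hd0] at hpos
    obtain ⟨f, h1, h2, h3⟩ := up hc0
    exact scaleP f h1 h2 (Pne f h1 h2 h3) h3 fun h => absurd h (by simp [← hd0])
  rcases hc.eq_or_lt with hc0 | hc0
  · obtain ⟨f, h1, h2, h3⟩ := down hd0
    have hη0 : 0 < η := hη.lt_of_ne fun h => by simp [← h, ← hc0] at hpos
    simp only [energy] at h3
    have hΛ : 0 < ‖Λ f‖ := (norm_nonneg _).lt_of_ne fun h => by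
      simp only [energy, ← h, ← hc0] at h2
      have : ‖f‖ ^ 2 = 0 := by rw [← h2]; ring
      simp [h1] at this
    have hsΛ : η / ‖Λ f‖ * ‖Λ f‖ = η := div_mul_cancel₀ _ hΛ.ne'
    have hle : η * ‖Vᗮ.starProjection f‖ ≤ ε * ‖Λ f‖ :=
      le_of_sq_le_sq (by linarith) (by positivity)
    refine scale f (η / ‖Λ f‖) (by positivity) h2 ?_ hsΛ.le ?_
    · rwa [div_mul_eq_mul_div, div_le_iff₀ hΛ]
    · rw [hsΛ]
      simp [← hc0]
  obtain ⟨f, hf0, hf, hf'⟩ := down hd0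
  obtain ⟨g, hg0, hg, hg'⟩ := up hc0
  obtain ⟨u, hu0, hu, hu'⟩ := exists_tight_energy_eq_zero hQ hf0 hg0 hf hg hf' hg'
  exact scaleP u hu0 hu (Pne u hu0 hu hu'.ge) hu'.ge fun _ => hu'

/-! ### Existence of a solution -/

theorem exists_isSDPSolution (hV : V ⊓ LinearMap.ker Λ = ⊥) (hε : 0 < ε) (hη : 0 < η) :
    ∃ c d : ℝ, IsSDPSolution V Λ ε η c d := by
  have hclosed : IsClosed (sdpFeasible V Λ) := by
    have : sdpFeasible V Λ = {p : ℝ × ℝ | 0 ≤ p.1} ∩ ({p | 0 ≤ p.2} ∩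
        ⋂ f : H, {p | ‖f‖ ^ 2 ≤ energy V Λ p.1 p.2 f}) := by
      ext ⟨c, d⟩
      simp [mem_sdpFeasible_iff]
    rw [this]
    refine (isClosed_le (by fun_prop) (by fun_prop)).inter
      ((isClosed_le (by fun_prop) (by fun_prop)).inter (isClosed_iInter fun f => ?_))
    unfold energy
    exact isClosed_le (by fun_prop) (by fun_prop)
  obtain ⟨γ, hγ, hle⟩ := exists_pos_mul_norm_sq_le_energy (V := V) (Λ := Λ) (c := 1) (d := 1)
    (γ₀ := 0) (fun f hf => by
      refine (energy_nonneg zero_le_one zero_le_one f).lt_of_ne fun h => ?_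
      have h1 : ‖Vᗮ.starProjection f‖ ^ 2 = 0 ∧ ‖Λ f‖ ^ 2 = 0 := by
        have := sq_nonneg ‖Vᗮ.starProjection f‖
        have := sq_nonneg ‖Λ f‖
        simp only [energy] at h
        constructor <;> linarith
      have hfV : f ∈ V ⊓ LinearMap.ker Λ := by
        refine ⟨?_, by simpa using h1.2⟩
        have h2 : Vᗮ.starProjection f = 0 := by simpa using h1.1
        rw [V.starProjection_orthogonal_val, sub_eq_zero] at h2
        exact V.starProjection_eq_self_iff.mp h2.symm
      rw [hV, Submodule.mem_bot] at hfV
      simp [hfV] at hf)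
  have hmem : (γ⁻¹, γ⁻¹) ∈ sdpFeasible V Λ := by
    refine mem_sdpFeasible_iff.mpr ⟨by positivity, by positivity, fun f => ?_⟩
    have h2 : energy V Λ γ⁻¹ γ⁻¹ f = energy V Λ 1 1 f / γ := by simp only [energy]; ring
    rw [h2, le_div_iff₀ hγ]
    linarith [hle f]
  let obj : ℝ × ℝ → ℝ := fun p => p.1 * ε ^ 2 + p.2 * η ^ 2
  have hobj : Continuous obj := by fun_prop
  set B := obj (γ⁻¹, γ⁻¹) with hB
  -- With both weights ε² and η² positive, a bound on the objective bounds c and d.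
  have hcomp : IsCompact (sdpFeasible V Λ ∩ {p | obj p ≤ B}) := by
    refine (isCompact_Icc (a := ((0, 0) : ℝ × ℝ)) (b := (B / ε ^ 2, B / η ^ 2))).of_isClosed_subset
      (hclosed.inter (isClosed_le hobj continuous_const)) ?_
    rintro ⟨c, d⟩ ⟨⟨hc, hd, -⟩, h⟩
    have h : c * ε ^ 2 + d * η ^ 2 ≤ B := h
    have hc : 0 ≤ c := hc
    have hd : 0 ≤ d := hd
    have : 0 ≤ c * ε ^ 2 := by positivity
    have : 0 ≤ d * η ^ 2 := by positivity
    refine ⟨⟨hc, hd⟩, ?_, ?_⟩ <;> simp only <;> rw [le_div_iff₀ (by positivity)] <;> linarith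
  obtain ⟨⟨c, d⟩, hp, hmin⟩ := hcomp.exists_isMinOn ⟨_, hmem, hB.ge⟩ hobj.continuousOn
  refine ⟨c, d, hp.1, fun p hp' => ?_⟩
  rcases le_total (obj p) B with h | h
  · exact hmin ⟨hp', h⟩
  · exact hp.2.trans h

/-! ### The regularization map and its error -/

theorem energyOp_injective (h : ∀ f : H, ‖f‖ ^ 2 ≤ energy V Λ c d f) :
    Function.Injective (energyOp V Λ c d) := by
  rw [injective_iff_map_eq_zero]
  intro f hf
  have h1 := h f
  rw [← re_inner_energyOp_self, hf, inner_zero_left, map_zero] at h1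
  simpa using le_antisymm h1 (sq_nonneg _)

/-- The linear map `(c P + d Λ* Λ)⁻¹ d Λ*`. -/
noncomputable def regMap (h : ∀ f : H, ‖f‖ ^ 2 ≤ energy V Λ c d f) : EuclideanSpace 𝕜 (Fin m) →ₗ[𝕜] H :=
  (LinearEquiv.ofInjectiveEndo (energyOp V Λ c d) (energyOp_injective h)).symm.toLinearMap ∘ₗ
    ((d : 𝕜) • LinearMap.adjoint Λ)

theorem energyOp_regMap (h : ∀ f : H, ‖f‖ ^ 2 ≤ energy V Λ c d f)
    (y : EuclideanSpace 𝕜 (Fin m)) :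
    energyOp V Λ c d (regMap h y) = (d : 𝕜) • LinearMap.adjoint Λ y :=
  (LinearEquiv.ofInjectiveEndo (energyOp V Λ c d) (energyOp_injective h)).apply_symm_apply _

/-- The error g solves (cP + dΛ*Λ)g = cPf - dΛ*e. Pairing with g and applying weighted
Cauchy–Schwarz bounds the energy of g by the right-hand side, and that energy dominates ‖g‖². -/
theorem norm_sub_regMap_sq_le (hc : 0 ≤ c) (hd : 0 ≤ d)
    (h : ∀ f : H, ‖f‖ ^ 2 ≤ energy V Λ c d f) (f : H) (e : EuclideanSpace 𝕜 (Fin m)) :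
    ‖f - regMap h (Λ f + e)‖ ^ 2 ≤ c * ‖Vᗮ.starProjection f‖ ^ 2 + d * ‖e‖ ^ 2 := by
  set g := f - regMap h (Λ f + e) with hg
  have h1 : energyOp V Λ c d g =
      (c : 𝕜) • Vᗮ.starProjection f - (d : 𝕜) • LinearMap.adjoint Λ e := by
    rw [hg, map_sub, energyOp_regMap]
    simp [energyOp, -Submodule.starProjection_orthogonal_val, smul_add]
    abel
  have h2 : energy V Λ c d g = c * RCLike.re ⟪Vᗮ.starProjection f, Vᗮ.starProjection g⟫_𝕜 +
      d * RCLike.re ⟪-e, Λ g⟫_𝕜 := by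
    rw [← re_inner_energyOp_self, h1, inner_sub_left, inner_smul_left, inner_smul_left,
      LinearMap.adjoint_inner_left, inner_starProjection_eq]
    simp [sub_eq_add_neg, -Submodule.starProjection_orthogonal_val]
  have h3 := re_inner_add_re_inner_le (𝕜 := 𝕜) hc hd (Vᗮ.starProjection f) (Vᗮ.starProjection g)
    (-e) (Λ g)
  rw [← h2, norm_neg] at h3
  have h4 := h g
  have h5 : energy V Λ c d g = c * ‖Vᗮ.starProjection g‖ ^ 2 + d * ‖Λ g‖ ^ 2 := rfl
  linarith

/-- The normal equation cancels the cross terms, so only the quadratic part in `g` remains; this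
yields minimality and uniqueness at once. -/
theorem regObjective_regMap_add (h : ∀ f : H, ‖f‖ ^ 2 ≤ energy V Λ c d f) (hcd : c + d ≠ 0)
    (y : EuclideanSpace 𝕜 (Fin m)) (g : H) :
    regObjective V Λ (d / (c + d)) y (regMap h y + g) =
      regObjective V Λ (d / (c + d)) y (regMap h y) + energy V Λ c d g / (c + d) := by
  have h1 : c * RCLike.re ⟪Vᗮ.starProjection (regMap h y), Vᗮ.starProjection g⟫_𝕜 +
      d * RCLike.re ⟪Λ (regMap h y) - y, Λ g⟫_𝕜 = 0 := by
    have h2 := congrArg (fun x => RCLike.re ⟪x, g⟫_𝕜) (energyOp_regMap h y)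
    simp only [inner_energyOp, inner_smul_left, LinearMap.adjoint_inner_left] at h2
    simp only [inner_sub_left, map_sub]
    simp [-Submodule.starProjection_orthogonal_val] at h2
    linarith
  have h3 := norm_add_sq (𝕜 := 𝕜) (Vᗮ.starProjection (regMap h y)) (Vᗮ.starProjection g)
  have h4 := norm_add_sq (𝕜 := 𝕜) (Λ (regMap h y) - y) (Λ g)
  have h5 : Λ (regMap h y) + Λ g - y = Λ (regMap h y) - y + Λ g := by abel
  simp only [regObjective, energy, map_add]
  rw [h5, h3, h4]
  field_simp
  linear_combination 2 * h1

theorem isRegularizationMap_regMap (hc : 0 ≤ c) (hd : 0 ≤ d)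
    (h : ∀ f : H, ‖f‖ ^ 2 ≤ energy V Λ c d f) :
    IsRegularizationMap V Λ (d / (c + d)) (regMap h) := by
  intro y f
  -- When c = d = 0, feasibility forces H to be trivial.
  rcases (add_nonneg hc hd).eq_or_lt with hcd | hcd
  · have hc0 : c = 0 := by linarith
    have hd0 : d = 0 := by linarith
    have : ∀ f : H, f = 0 := fun f => by
      have h1 := h f
      simp only [energy, hc0, hd0, zero_mul, add_zero] at h1
      simpa using le_antisymm h1 (sq_nonneg _)
    refine ⟨fun _ => by rw [this f, this (regMap h y)], fun _ g _ => ?_⟩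
    exact (congrArg (regObjective V Λ (d / (c + d)) y) ((this f).trans (this g).symm)).le
  have key : ∀ g, regObjective V Λ (d / (c + d)) y g =
      regObjective V Λ (d / (c + d)) y (regMap h y) +
        energy V Λ c d (g - regMap h y) / (c + d) := fun g => by
    rw [← regObjective_regMap_add h hcd.ne', add_sub_cancel]
  constructor
  · intro hmin
    have h1 : regObjective V Λ (d / (c + d)) y f ≤ regObjective V Λ (d / (c + d)) y (regMap h y) :=
      hmin (Set.mem_univ _)
    rw [key f] at h1
    have h2 : energy V Λ c d (f - regMap h y) / (c + d) ≤ 0 := by linarith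
    rw [div_le_iff₀ hcd, zero_mul] at h2
    have h3 : ‖f - regMap h y‖ ^ 2 = 0 := le_antisymm ((h _).trans h2) (sq_nonneg _)
    simpa [sub_eq_zero] using h3
  · rintro rfl g -
    rw [Set.mem_ofPred_eq, key g]
    have := div_nonneg (energy_nonneg (V := V) (Λ := Λ) hc hd (g - regMap h y)) hcd.le
    linarith

end

end OptRec

theorem mainTheorem3 {𝕜 : Type*} [RCLike 𝕜] {H : Type*} [NormedAddCommGroup H]
    [InnerProductSpace 𝕜 H] [FiniteDimensional 𝕜 H] {m : ℕ}
    (V : Submodule 𝕜 H) (Λ : H →ₗ[𝕜] EuclideanSpace 𝕜 (Fin m))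
    (hV : V ⊓ LinearMap.ker Λ = ⊥) (ε η : ℝ) (hε : 0 < ε) (hη : 0 ≤ η) :
    (0 < η → ∃ c d : ℝ, OptRec.IsSDPSolution V Λ ε η c d) ∧
    ∀ c d : ℝ, OptRec.IsSDPSolution V Λ ε η c d →
      ∃ Δ : EuclideanSpace 𝕜 (Fin m) →ₗ[𝕜] H,
        OptRec.IsRegularizationMap V Λ (d / (c + d)) Δ ∧
        OptRec.gwce (OptRec.approxSet V ε) (OptRec.uncertaintySet 𝕜 m η) Λ Δ =
          ⨅ Δ' : EuclideanSpace 𝕜 (Fin m) → H,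
            OptRec.gwce (OptRec.approxSet V ε) (OptRec.uncertaintySet 𝕜 m η) Λ Δ' := by
  refine ⟨OptRec.exists_isSDPSolution hV hε, fun c d hs => ?_⟩
  obtain ⟨hc, hd, h⟩ := OptRec.mem_sdpFeasible_iff.mp hs.1
  refine ⟨OptRec.regMap h, OptRec.isRegularizationMap_regMap hc hd h,
    le_antisymm (le_iInf fun Δ' => ?_) (iInf_le _ _)⟩
  obtain ⟨f, hfP, hfΛ, hf⟩ := hs.exists_le_norm_sq hε hη
  refine le_trans ?_ (OptRec.enorm_le_gwce Δ' (f := f) ?_ ?_ ?_ ?_)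
  · refine iSup₂_le fun g hg => iSup₂_le fun e he => ?_
    rw [enorm_le_iff_norm_le]
    refine le_of_sq_le_sq ((OptRec.norm_sub_regMap_sq_le hc hd h g e).trans (le_trans ?_ hf))
      (norm_nonneg _)
    have hg' : ‖Vᗮ.starProjection g‖ ≤ ε :=
      (OptRec.infDist_eq_norm_starProjection_orthogonal V g).symm.trans_le hg
    have he' : ‖e‖ ≤ η := he
    gcongr
  · exact (OptRec.infDist_eq_norm_starProjection_orthogonal V f).trans_le hfP
  · refine (OptRec.infDist_eq_norm_starProjection_orthogonal V (-f)).trans_le ?_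
    rwa [map_neg, norm_neg]
  · exact hfΛ
  · exact (norm_neg (Λ f)).trans_le hfΛ
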